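/- **Conventions.** All spaces $\mathbb R^k$ carry the Euclidean norm. A fully connected network with input size $p$, hidden widths $n_1,\dots,n_{L-1}$ and output size $q$ is a map $N_\theta=z^{(L)}\circ\cdots\circ z^{(1)}:\mathbb R^p\to\mathbb R^q$, $z^{(\ell)}(y)=\sigma^{(\ell)}(W^{(\ell)}y+b^{(\ell)})$, where $n_0=p$, $n_L=q$, $W^{(\ell)}\in\mathbb R^{n_\ell\times n_{\ell-1}}$, $b^{(\ell)}\in\mathbb R^{n_\ell}$, and $\sigma^{(\ell)}:\mathbb R\to\mathbb R$ acts on each coordinate; $\theta$ collects all $W^{(\ell)},b^{(\ell)}$ and $|\theta|$ is their total number of entries. A ReLU network uses $\max(\cdot,0)$ in the hidden layers and the identity in the output layer. Call $\sigma$ admissible if it is continuously differentiable near some point at which its derivative is non-zero (e.g. ReLU, PReLU, ELU, $\tanh$, identity). For $\mathcal M\subset\mathbb R^N$, an exact autoencoder is a pair of continuous maps $\Psi':\mathbb R^N\to\mathbb R^n$, $\Psi:\mathbb R^n\to\mathbb R^N$ with $\Psi(\Psi'(x))=x$ for all $x\in\mathcal M$; a map $\mathbb R^N\to\mathbb R^n$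 has zero representation error on $\mathcal M$ ($\varepsilon_1=0$) if it is injective on $\mathcal M$ and some continuous decoder $\mathbb R^n\to\mathbb R^N$ recovers every $x\in\mathcal M$ exactly from its code. An $m$-manifold in $\mathbb R^N$ is a subset which, in the subspace topology, is a topological $m$-manifold, possibly with boundary and corners, with given charts; it is Lipschitz parametrised if around each of its points the inverse of the chart there is a Lipschitz map into $\mathbb R^N$ (e.g. every $C^1$ submanifold with its $C^1$ charts). **Theorem (sufficient condition for $\varepsilon_1=0$).** Let $\mathcal M\subset\mathbb R^N$ be a compact $m$-manifold and let $m\le n<N$. 1. If $n\ge 2m+1$, then $\mathcal M$ has an exact autoencoder with latent size $n$. 2. Let $n\ge 2m+1$ and let $\mathcal M$ be Lipschitz parametrised. For every $L\ge1$, all hidden widths $n_1,\dots,n_{L-1}$ with $n_\ell\ge n_{\rm in}=N$, and all admissible activation functions $\sigma^{(1)},\dots,\sigma^{(L)}$, there are weights $\theta$ for which the encoder network $N_\theta:\mathbb R^N\to\mathbb R^n$ is injective on $\mathcal M$ and has zero representation error on $\mathcal M$. 3. Hidden widths $n_\ell=n_{\rm in}+n_{\rm out}=N+n$ suffice for zero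 representation error and an approximation error that vanishes as $|\theta|\to\infty$: let $(\Psi',\Psi)$ be any exact autoencoder on $\mathcal M$ with latent size $n$. For every $\varepsilon>0$ there is $P\in\mathbb N$ such that for every encoder architecture $\mathbb R^N\to\mathbb R^n$ whose hidden layers all have width $N+n$ and which has at least $P$ weights, there are weights $\theta$ whose ReLU network $N_\theta$ satisfies - $\|N_\theta(x)-\Psi'(x)\|\le\varepsilon$ for all $x\in\mathcal M$; - if $n\ge2m+1$ and $\mathcal M$ is Lipschitz parametrised, then moreover $N_\theta$ is injective on $\mathcal M$ with zero representation error; - for every decoder architecture $\mathbb R^n\to\mathbb R^N$ whose hidden layers all have width $n+N$ and which has at least $P$ weights, there are weights $\theta'$ whose ReLU network satisfies $\|N_{\theta'}(\Psi'(x))-x\|\le\varepsilon$ and $\|N_{\theta'}(N_\theta(x))-x\|\le\varepsilon$ for all $x\in\mathcal M$. -/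

import Mathlib

open Set Filter Topology
open scoped Manifold NNReal

/-- `ℝᵏ` with its Euclidean norm. -/
abbrev Euc (k : ℕ) : Type := EuclideanSpace ℝ (Fin k)

/-! ### Fully connected feed-forward networks -/

/-- Weights and bias `(W, b)` of one fully connected layer `ℝᵖ → ℝ^q`. -/
abbrev LayerParams (p q : ℕ) : Type := Matrix (Fin q) (Fin p) ℝ × (Fin q → ℝ)

/-- The layer map `y ↦ σ (W y + b)`, with `σ` applied to every coordinate. -/
noncomputable def layerMap {p q : ℕ} (σ : ℝ → ℝ) (θ : LayerParams p q) (y : Euc p) : Euc q :=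
  WithLp.toLp 2 fun i => σ (θ.1.mulVec y.ofLp i + θ.2 i)

/-- All weights of a fully connected network with input size `p`, output size `q` and the given
list of widths of the hidden layers (from the input to the output). A network with `L` layers has
`L - 1` hidden layers. -/
def NetParams : ℕ → List ℕ → ℕ → Type
  | p, [], q => LayerParams p q
  | p, h :: hs, q => LayerParams p h × NetParams h hs q

/-- The map computed by the network. Layer `ℓ + 1` has activation function `σ ℓ`, so that the
hidden layers use `σ 0, …, σ (L - 2)` and the output layer uses `σ (L - 1)`. -/
noncomputable def netMap (σ : ℕ → ℝ → ℝ) :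
    {p : ℕ} → (hs : List ℕ) → {q : ℕ} → NetParams p hs q → Euc p → Euc q
  | _, [], _, θ => fun x => layerMap (σ 0) θ x
  | _, _ :: hs, _, θ => fun x =>
      netMap (fun ℓ => σ (ℓ + 1)) hs θ.2 (layerMap (σ 0) θ.1 x)

/-- The number of entries of all weight matrices and biases of the network. -/
def numParams : ℕ → List ℕ → ℕ → ℕ
  | p, [], q => q * p + q
  | p, h :: hs, q => (h * p + h) + numParams h hs q

/-- The activation function is continuously differentiable near some point and its derivative does
not vanish there (ReLU, PReLU, ELU, tanh, the logistic function, the identity, …). -/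
def IsAdmissibleActivation (σ : ℝ → ℝ) : Prop :=
  ∃ t : ℝ, ContDiffAt ℝ 1 σ t ∧ deriv σ t ≠ 0

/-- The rectified linear unit. -/
noncomputable def relu (x : ℝ) : ℝ := max x 0

/-- Activations of a ReLU network with `d` hidden layers: ReLU in the hidden layers, and an affine
output layer. -/
noncomputable def reluActivation (d : ℕ) (ℓ : ℕ) : ℝ → ℝ := if ℓ < d then relu else id

/-- ReLU networks `ℝᵖ → ℝ^q` with `d` hidden layers, all of width `w`: the map with weights `θ`. -/
noncomputable def reluNet {p q : ℕ} (d w : ℕ) (θ : NetParams p (List.replicate d w) q) :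
    Euc p → Euc q :=
  netMap (reluActivation d) (List.replicate d w) θ

/-! ### Autoencoders on a set `M ⊆ ℝᴺ` -/

/-- The pair `(E, D)` is an exact continuous autoencoder on `M`: `D ∘ E` is the identity of `M`. -/
structure IsExactAutoencoder {N n : ℕ} (M : Set (Euc N)) (E : Euc N → Euc n)
    (D : Euc n → Euc N) : Prop where
  continuous_encoder : Continuous E
  continuous_decoder : Continuous D
  decode_encode : ∀ x ∈ M, D (E x) = x

/-- The encoder `E` has zero representation error on `M`: it is injective on `M`, and the points
of `M` are recovered exactly from their codes by some continuous decoder. -/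
def HasZeroRepresentationError {N n : ℕ} (M : Set (Euc N)) (E : Euc N → Euc n) : Prop :=
  InjOn E M ∧ ∃ D : Euc n → Euc N, Continuous D ∧ ∀ x ∈ M, D (E x) = x

/-! ### Lipschitz manifolds in `ℝᴺ` -/

/-- The manifold `M ⊆ ℝᴺ` is locally Lipschitz parametrised: for every `p : M`, the inverse of the
chart at `p` is a Lipschitz map into `ℝᴺ` near the image of `p`. Every `C¹` submanifold with its
`C¹` charts has this property. -/
def IsLipschitzParametrized {m N : ℕ} {H : Type*} [TopologicalSpace H]
    (I : ModelWithCorners ℝ (Euc m) H) (M : Set (Euc N)) [ChartedSpace H M] : Prop :=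
  ∀ p : M, ∃ K : ℝ≥0, ∃ t ∈ 𝓝[range I] (extChartAt I p p),
    LipschitzOnWith K (fun u : Euc m => (((extChartAt I p).symm u : M) : Euc N)) t

/-! Approximation rests on convexity. If p has maximal norm in a compact set, then ⟪p, p - x⟫ ≥ ‖p -
x‖²/2 on it, so for large B the affine functions f(p) ∓ B⟪p, p - x⟫ bound f from below and above up
to ε and pinch it near p. Removing a small ball and recursing yields a chain of affine max/min steps
(`exists_clampChain_of_cover`), which a ReLU network of width N + n computes while carrying its
input along (`exists_reluNet_eq_clampChain`).

Injectivity is a dimension count. If dimH (M × M) < n and g is Lipschitz, the perturbations x ↦ g x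
+ T x with collisions are exceptional, so arbitrarily small good T exist
(`exists_small_injective_perturbation`). Lipschitz charts give dimH (M × M) ≤ 2m, and Lipschitz
layers preserve this bound. For merely continuous charts the count applies to Lipschitz
approximations on pairs of chart pieces, and Baire's theorem combines these into an injection
(`exists_injective_continuousMap`). On a compact set, Tietze's theorem gives every continuous
injection an exact decoder. -/

/-! ### Clamp chains -/

/-- The coordinatewise rectifier. -/
noncomputable def rectify {k : ℕ} (v : Euc k) : Euc k := WithLp.toLp 2 fun i => relu (v i)

@[simp]
theorem rectify_apply {k : ℕ} (v : Euc k) (i : Fin k) : rectify v i = relu (v i) := rfl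

theorem relu_sub_le (a b : ℝ) : |relu a - relu b| ≤ |a - b| :=
  abs_max_sub_max_le_abs a b 0

theorem lipschitzWith_rectify (k : ℕ) : LipschitzWith 1 (rectify : Euc k → Euc k) := by
  refine LipschitzWith.of_dist_le_mul fun v w => ?_
  rw [NNReal.coe_one, one_mul, EuclideanSpace.dist_eq, EuclideanSpace.dist_eq]
  refine Real.sqrt_le_sqrt (Finset.sum_le_sum fun i _ => ?_)
  rw [Real.dist_eq, Real.dist_eq]
  exact pow_le_pow_left₀ (abs_nonneg _) (relu_sub_le _ _) 2

/-- One step of a chain: for `a.1 = 1` it takes the coordinatewise maximum with the affine map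
`a.2`, and for `a.1 = -1` the coordinatewise minimum. -/
noncomputable def clampStep {N n : ℕ} (x : Euc N) (s : Euc n) (a : ℝ × (Euc N →ᵃ[ℝ] Euc n)) :
    Euc n :=
  a.2 x + a.1 • rectify (a.1 • (s - a.2 x))

/-- The steps of a list, applied one after the other to the initial value `s`. -/
noncomputable def clampChain {N n : ℕ} (l : List (ℝ × (Euc N →ᵃ[ℝ] Euc n))) (x : Euc N)
    (s : Euc n) : Euc n :=
  l.foldl (clampStep x) s

theorem clampStep_max {N n : ℕ} (x : Euc N) (s : Euc n) (A : Euc N →ᵃ[ℝ] Euc n) (i : Fin n) :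
    clampStep x s (1, A) i = max (s i) (A x i) := by
  simp only [clampStep, one_smul, PiLp.add_apply, rectify_apply, PiLp.sub_apply, relu]
  rw [← max_add_add_left]
  simp

theorem clampStep_min {N n : ℕ} (x : Euc N) (s : Euc n) (A : Euc N →ᵃ[ℝ] Euc n) (i : Fin n) :
    clampStep x s (-1, A) i = min (s i) (A x i) := by
  simp only [clampStep, PiLp.add_apply, PiLp.smul_apply, rectify_apply, PiLp.sub_apply, relu,
    smul_eq_mul]
  rcases le_total (s i) (A x i) with h | h
  · rw [max_eq_left (by linarith), min_eq_left h]; ring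
  · rw [max_eq_right (by linarith), min_eq_right h]; ring

theorem exists_lipschitzWith_affineMap {N n : ℕ} (A : Euc N →ᵃ[ℝ] Euc n) :
    ∃ K : ℝ≥0, LipschitzWith K A := by
  refine ⟨‖A.linear.toContinuousLinearMap‖₊, LipschitzWith.of_dist_le_mul fun x y => ?_⟩
  rw [dist_eq_norm, dist_eq_norm, ← vsub_eq_sub (A x), ← A.linearMap_vsub]
  exact A.linear.toContinuousLinearMap.le_opNorm _

/-- Only the existence of a constant matters: Lipschitz maps do not raise Hausdorff dimension. -/
theorem exists_lipschitzWith_clampChain {N n : ℕ} (l : List (ℝ × (Euc N →ᵃ[ℝ] Euc n)))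
    (f : Euc N → Euc n) (hf : ∃ K : ℝ≥0, LipschitzWith K f) :
    ∃ K : ℝ≥0, LipschitzWith K fun x => clampChain l x (f x) := by
  induction l generalizing f with
  | nil => exact hf
  | cons a l ih =>
    refine ih (fun x => clampStep x (f x) a) ?_
    obtain ⟨K, hK⟩ := hf
    obtain ⟨C, hC⟩ := exists_lipschitzWith_affineMap a.2
    have h1 : LipschitzWith (‖a.1‖₊ * (K + C)) fun x => a.1 • (f x - a.2 x) :=
      (lipschitzWith_smul a.1).comp (hK.sub hC)
    exact ⟨_, hC.add ((lipschitzWith_smul a.1).comp ((lipschitzWith_rectify n).comp h1))⟩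

theorem exists_affineMap_inner {N n : ℕ} (p : Euc N) (a : Euc n) (b : ℝ) :
    ∃ A : Euc N →ᵃ[ℝ] Euc n, ∀ x i, A x i = a i + b * inner ℝ p (p - x) := by
  let L : Euc N →ₗ[ℝ] Euc n :=
    ((-b) • ((innerSL ℝ p).smulRight (WithLp.toLp 2 fun _ => (1 : ℝ)))).toLinearMap
  refine ⟨L.toAffineMap + AffineMap.const ℝ _
    (a + (b * inner ℝ p p) • WithLp.toLp 2 fun _ => (1 : ℝ)), fun x i => ?_⟩
  simp [L, inner_sub_right]
  ring

/-- Chains that are exact up to `ε` on a compact set `S`, built by removing small pieces of `S`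
around points of maximal norm. -/
theorem exists_clampChain_of_cover {N n : ℕ} (f : Euc N → Euc n) {K : Set (Euc N)}
    {ε δ C R B η : ℝ} (hB : 0 ≤ B) (hε : 0 < ε) (hηδ : η ≤ δ)
    (hf : ∀ x ∈ K, ∀ y ∈ K, dist x y < δ → ∀ i, |f x i - f y i| ≤ ε / 2)
    (hC : ∀ x ∈ K, ∀ i, |f x i| ≤ C) (hR : ∀ x ∈ K, ‖x‖ ≤ R)
    (hBδ : 2 * C ≤ B * (δ ^ 2 / 2)) (hBη : B * (R * η) ≤ ε / 2) (hδ : 0 < δ)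
    (T : Finset (Euc N)) :
    ∀ S ⊆ K, IsCompact S → (S ⊆ ⋃ c ∈ T, Metric.ball c (η / 2)) →
      ∃ d₀ : ℕ, ∀ d, d₀ ≤ d → ∃ l : List (ℝ × (Euc N →ᵃ[ℝ] Euc n)), l.length = d ∧
        ∀ x ∈ S, ∀ i, |clampChain l x 0 i - f x i| ≤ ε := by
  induction T using Finset.strongInduction with
  | H T ih =>
  intro S hSK hS hcov
  rcases S.eq_empty_or_nonempty with rfl | hne
  -- On the empty set arbitrary steps pad the chain to any length.
  · exact ⟨0, fun d _ => ⟨List.replicate d (1, 0), by simp, by simp⟩⟩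
  obtain ⟨p, hpS, hp⟩ := hS.exists_isMaxOn hne continuous_norm.continuousOn
  obtain ⟨c, hcT, hpc⟩ : ∃ c ∈ T, p ∈ Metric.ball c (η / 2) := by
    simpa using hcov hpS
  obtain ⟨d₀, hd₀⟩ := ih (T.erase c) (Finset.erase_ssubset hcT) (S \ Metric.ball c (η / 2))
    (sdiff_subset.trans hSK) (hS.diff Metric.isOpen_ball) (by
      rintro x ⟨hxS, hxc⟩
      obtain ⟨c', hc', hx⟩ : ∃ c ∈ T, x ∈ Metric.ball c (η / 2) := by simpa using hcov hxS
      refine mem_iUnion₂.2 ⟨c', Finset.mem_erase.2 ⟨?_, hc'⟩, hx⟩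
      rintro rfl
      exact hxc hx)
  obtain ⟨A₁, hA₁⟩ := exists_affineMap_inner p (f p) (-B)
  obtain ⟨A₂, hA₂⟩ := exists_affineMap_inner p (f p) B
  -- Since ‖x‖ ≤ ‖p‖, ‖p - x‖² = ‖p‖² - 2⟪p, x⟫ + ‖x‖² ≤ 2⟪p, p - x⟫.
  have hlow : ∀ x ∈ S, dist p x ^ 2 / 2 ≤ inner ℝ p (p - x) := by
    intro x hx
    have h1 : ‖x‖ ^ 2 ≤ ‖p‖ ^ 2 := pow_le_pow_left₀ (norm_nonneg _) (hp hx) 2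
    have h2 := norm_sub_sq_real p x
    rw [dist_eq_norm, inner_sub_right, real_inner_self_eq_norm_sq]
    linarith
  have hup : ∀ x ∈ S, x ∈ Metric.ball c (η / 2) → B * inner ℝ p (p - x) ≤ ε / 2 := by
    intro x hx hxc
    refine le_trans (mul_le_mul_of_nonneg_left ?_ hB) hBη
    have hd : dist p x < η := by
      have := dist_triangle_right p x c
      rw [Metric.mem_ball] at hpc hxc
      linarith
    refine (real_inner_le_norm _ _).trans ?_
    rw [← dist_eq_norm]
    exact mul_le_mul (hR p (hSK hpS)) hd.le dist_nonneg
      ((norm_nonneg _).trans (hR p (hSK hpS)))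
  have hnear : ∀ x ∈ S, x ∈ Metric.ball c (η / 2) → ∀ i, |f p i - f x i| ≤ ε / 2 := by
    intro x hx hxc
    refine hf p (hSK hpS) x (hSK hx) ?_
    have := dist_triangle_right p x c
    rw [Metric.mem_ball] at hpc hxc
    linarith
  -- Within `δ` of `p` uniform continuity suffices; farther away the slope term is at least the
  -- oscillation bound `2 * C`.
  have hall : ∀ x ∈ S, ∀ i, |f p i - f x i| ≤ ε + B * inner ℝ p (p - x) := by
    intro x hx i
    have h0 := mul_le_mul_of_nonneg_left (hlow x hx) hB
    rcases lt_or_ge (dist p x) δ with h | h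
    · have h1 := hf p (hSK hpS) x (hSK hx) h i
      have h2 : 0 ≤ B * (dist p x ^ 2 / 2) := by positivity
      linarith
    · have h1 : B * (δ ^ 2 / 2) ≤ B * (dist p x ^ 2 / 2) := by gcongr
      have h2 := abs_sub (f p i) (f x i)
      have h3 := hC p (hSK hpS) i
      have h4 := hC x (hSK hx) i
      linarith
  refine ⟨d₀ + 2, fun d hd => ?_⟩
  obtain ⟨l, hl, hlS⟩ := hd₀ (d - 2) (by omega)
  -- The new clamp acts last: on the ball it forces accuracy by itself, elsewhere it preserves the
  -- accuracy of `l`.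
  refine ⟨l ++ [(1, A₁), (-1, A₂)], by simp [hl]; omega, fun x hx i => ?_⟩
  have hval : clampChain (l ++ [(1, A₁), (-1, A₂)]) x 0 i =
      min (max (clampChain l x 0 i) (A₁ x i)) (A₂ x i) := by
    simp only [clampChain, List.foldl_append, List.foldl_cons, List.foldl_nil]
    rw [clampStep_min, clampStep_max]
  rw [hval, hA₁, hA₂]
  have h1 := abs_le.1 (hall x hx i)
  by_cases hxc : x ∈ Metric.ball c (η / 2)
  · have h2 := abs_le.1 (hnear x hx hxc i)
    have h3 := hup x hx hxc
    rw [abs_le]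
    constructor
    · have : f x i - ε ≤ min (max (clampChain l x 0 i) (f p i + -B * inner ℝ p (p - x)))
          (f p i + B * inner ℝ p (p - x)) :=
        le_min (le_max_of_le_right (by linarith)) (by linarith)
      linarith
    · have := min_le_right (max (clampChain l x 0 i) (f p i + -B * inner ℝ p (p - x)))
          (f p i + B * inner ℝ p (p - x))
      linarith
  · have h2 := abs_le.1 (hlS x ⟨hx, hxc⟩ i)
    rw [abs_le]
    constructor
    · have : f x i - ε ≤ min (max (clampChain l x 0 i) (f p i + -B * inner ℝ p (p - x)))
          (f p i + B * inner ℝ p (p - x)) :=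
        le_min (le_max_of_le_left (by linarith)) (by linarith)
      linarith
    · have := min_le_left (max (clampChain l x 0 i) (f p i + -B * inner ℝ p (p - x)))
          (f p i + B * inner ℝ p (p - x))
      have h4 : max (clampChain l x 0 i) (f p i + -B * inner ℝ p (p - x)) ≤ f x i + ε :=
        max_le (by linarith) (by linarith)
      linarith

theorem norm_le_of_forall_abs_le {n : ℕ} {v : Euc n} {ε : ℝ} (hε : 0 ≤ ε)
    (h : ∀ i, |v i| ≤ ε / (n + 1)) : ‖v‖ ≤ ε := by
  rw [EuclideanSpace.norm_eq]
  refine Real.sqrt_le_iff.2 ⟨hε, ?_⟩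
  have h1 : ∀ i ∈ Finset.univ, ‖v i‖ ^ 2 ≤ (ε / (n + 1)) ^ 2 := fun i _ =>
    pow_le_pow_left₀ (norm_nonneg _) (h i) 2
  refine (Finset.sum_le_sum h1).trans ?_
  rw [Finset.sum_const, Finset.card_univ, Fintype.card_fin, nsmul_eq_mul, div_pow,
    mul_div_assoc', div_le_iff₀ (by positivity)]
  have : (n : ℝ) ≤ (n + 1) ^ 2 := by nlinarith [(Nat.cast_nonneg n : (0 : ℝ) ≤ n)]
  nlinarith [sq_nonneg ε]

/-- Clamp chains of every sufficiently large length approximate a given continuous map uniformly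
on a compact set. -/
theorem exists_clampChain_approx {N n : ℕ} {f : Euc N → Euc n} (hf : Continuous f)
    {K : Set (Euc N)} (hK : IsCompact K) {ε : ℝ} (hε : 0 < ε) :
    ∃ d₀ : ℕ, ∀ d, d₀ ≤ d → ∃ l : List (ℝ × (Euc N →ᵃ[ℝ] Euc n)), l.length = d ∧
      ∀ x ∈ K, ‖clampChain l x 0 - f x‖ ≤ ε := by
  obtain ⟨R, hR⟩ := hK.isBounded.exists_norm_le
  obtain ⟨C, hC⟩ := (hK.image hf).isBounded.exists_norm_le
  set ε' : ℝ := ε / (n + 1) with hε'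
  have hε'0 : 0 < ε' := by positivity
  have huc := hK.uniformContinuousOn_of_continuous hf.continuousOn
  obtain ⟨δ, hδ, hfδ⟩ := Metric.uniformContinuousOn_iff.1 huc (ε' / 2) (by positivity)
  -- `B` makes the slope term reach `2 * |C|` at distance `δ`; `η` then keeps it below `ε' / 2` on
  -- each ball.
  set B : ℝ := 4 * |C| / δ ^ 2 with hB
  set η : ℝ := min δ (ε' / 2 / (B * |R| + 1)) with hη
  have hB0 : 0 ≤ B := by positivity
  have hη0 : 0 < η := lt_min hδ (by positivity)
  obtain ⟨T, -, hT, hcov⟩ := hK.finite_cover_balls (half_pos hη0)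
  obtain ⟨d₀, h⟩ := exists_clampChain_of_cover (n := n) f (K := K) (ε := ε') (δ := δ) (C := |C|)
    (R := |R|) (B := B) (η := η) hB0 hε'0 (min_le_left _ _) (fun x hx y hy hxy i => by
      have := hfδ x hx y hy hxy
      rw [dist_eq_norm] at this
      exact (PiLp.norm_apply_le (f x - f y) i).trans this.le)
    (fun x hx i => (PiLp.norm_apply_le (f x) i).trans
      ((hC _ (mem_image_of_mem f hx)).trans (le_abs_self C)))
    (fun x hx => (hR x hx).trans (le_abs_self R))
    (by rw [hB]; field_simp; linarith)
    (by
      have h1 : η * (B * |R| + 1) ≤ ε' / 2 :=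
        (le_div_iff₀ (by positivity)).1 (min_le_right _ _)
      nlinarith)
    hδ hT.toFinset K Subset.rfl hK (by simpa using hcov)
  refine ⟨d₀, fun d hd => ?_⟩
  obtain ⟨l, hl, hlK⟩ := h d hd
  exact ⟨l, hl, fun x hx => norm_le_of_forall_abs_le hε.le fun i => hlK x hx i⟩

/-! ### Chains as ReLU networks -/

theorem exists_affineMap_of_coords {p q : ℕ} (F : Fin q → Euc p →ᵃ[ℝ] ℝ) :
    ∃ A : Euc p →ᵃ[ℝ] Euc q, ∀ y i, A y i = F i y :=
  ⟨(WithLp.linearEquiv 2 ℝ (Fin q → ℝ)).symm.toLinearMap.toAffineMap.comp (AffineMap.pi F),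
    fun _ _ => rfl⟩

/-- The `i`-th coordinate as an affine map. -/
noncomputable def coordAffine {k : ℕ} (i : Fin k) : Euc k →ᵃ[ℝ] ℝ :=
  (EuclideanSpace.proj i : Euc k →L[ℝ] ℝ).toLinearMap.toAffineMap

@[simp]
theorem coordAffine_apply {k : ℕ} (i : Fin k) (v : Euc k) : coordAffine i v = v i := rfl

theorem exists_layerParams {p q : ℕ} (A : Euc p →ᵃ[ℝ] Euc q) :
    ∃ θ : LayerParams p q, ∀ (σ : ℝ → ℝ) (y : Euc p),
      layerMap σ θ y = WithLp.toLp 2 fun i => σ (A y i) := by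
  refine ⟨(LinearMap.toMatrix' ((WithLp.linearEquiv 2 ℝ (Fin q → ℝ)).toLinearMap ∘ₗ A.linear ∘ₗ
    (WithLp.linearEquiv 2 ℝ (Fin p → ℝ)).symm.toLinearMap), (A 0).ofLp), fun σ y => ?_⟩
  unfold layerMap
  congr 1
  funext i
  congr 1
  rw [LinearMap.toMatrix'_mulVec]
  have h : A y = A.linear y + A 0 := by
    have := congrFun A.decomp y
    simpa using this
  rw [h]
  rfl

theorem reluActivation_succ (d : ℕ) :
    (fun ℓ => reluActivation (d + 1) (ℓ + 1)) = reluActivation d := by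
  funext ℓ
  simp [reluActivation]

theorem relu_of_nonneg {x : ℝ} (hx : 0 ≤ x) : relu x = x := max_eq_left hx

/-- The chain with steps `l`, plus a linear map, is computed by a ReLU network of width `N + n`
which carries along its input in `N` of its coordinates. -/
theorem exists_reluNet_eq_clampChain {N n : ℕ} (T : Euc N →ₗ[ℝ] Euc n) (c : ℝ)
    (l : List (ℝ × (Euc N →ᵃ[ℝ] Euc n))) :
    ∀ {p : ℕ} (X : Euc p →ᵃ[ℝ] Euc N) (A : Euc p →ᵃ[ℝ] Euc n),
      ∃ θ : NetParams p (List.replicate l.length (N + n)) n, ∀ y : Euc p,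
        (∀ i, 0 ≤ X y i + c) →
          reluNet l.length (N + n) θ y = clampChain l (X y) (A y) + T (X y) := by
  induction l with
  | nil =>
    intro p X A
    obtain ⟨θ, hθ⟩ := exists_layerParams (A + T.toAffineMap.comp X)
    refine ⟨θ, fun y _ => ?_⟩
    change layerMap (reluActivation 0 0) θ y = _
    rw [hθ]
    simp [reluActivation, clampChain]
    rfl
  | cons a l ih =>
    intro p X A
    -- The shift by `c` makes the carried input nonnegative, so ReLU passes it unchanged. The other
    -- `n` units hold only the rectified part of the step; the next layer restores its affine part
    -- from the carried input.
    obtain ⟨G, hG⟩ := exists_affineMap_of_coords (p := p) (Fin.append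
      (fun i : Fin N => (coordAffine i).comp X + AffineMap.const ℝ _ c)
      (fun i : Fin n => (coordAffine i).comp (a.1 • (A - a.2.comp X))))
    obtain ⟨X', hX'⟩ := exists_affineMap_of_coords (p := N + n)
      (fun i : Fin N => coordAffine (Fin.castAdd n i) - AffineMap.const ℝ _ c)
    obtain ⟨R, hR⟩ := exists_affineMap_of_coords (p := N + n)
      (fun i : Fin n => coordAffine (Fin.natAdd N i))
    obtain ⟨θ, hθ⟩ := ih X' (a.2.comp X' + a.1 • R)
    obtain ⟨θ₁, hθ₁⟩ := exists_layerParams G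
    refine ⟨(θ₁, θ), fun y hy => ?_⟩
    change netMap (fun ℓ => reluActivation (l.length + 1) (ℓ + 1)) _ θ
      (layerMap (reluActivation (l.length + 1) 0) θ₁ y) = _
    rw [reluActivation_succ, hθ₁]
    have hrelu : reluActivation (l.length + 1) 0 = relu := by simp [reluActivation]
    rw [hrelu]
    set z : Euc (N + n) := WithLp.toLp 2 fun i => relu (G y i) with hz
    have hXz : X' z = X y := by
      ext i
      rw [hX']
      have : G y (Fin.castAdd n i) = X y i + c := by rw [hG]; simp
      simp [hz, this, relu_of_nonneg (hy i)]
    have hRz : R z = rectify (a.1 • (A y - a.2 (X y))) := by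
      ext i
      rw [hR]
      have : G y (Fin.natAdd N i) = (a.1 • (A y - a.2 (X y))) i := by rw [hG]; simp
      simp [hz, this]
    have := hθ z (by rw [hXz]; exact hy)
    rw [hXz] at this
    refine this.trans ?_
    simp [hXz, hRz, clampChain, clampStep]

theorem exists_reluNet_eq_on {N n : ℕ} {K : Set (Euc N)} (hK : IsCompact K)
    (T : Euc N →L[ℝ] Euc n) (l : List (ℝ × (Euc N →ᵃ[ℝ] Euc n))) :
    ∃ θ : NetParams N (List.replicate l.length (N + n)) n, ∀ x ∈ K,
      reluNet l.length (N + n) θ x = clampChain l x 0 + T x := by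
  obtain ⟨R, hR⟩ := hK.isBounded.exists_norm_le
  obtain ⟨θ, hθ⟩ := exists_reluNet_eq_clampChain T.toLinearMap R l (AffineMap.id ℝ (Euc N)) 0
  refine ⟨θ, fun x hx => ?_⟩
  have := hθ x fun i => by
    have h1 := (PiLp.norm_apply_le x i).trans (hR x hx)
    rw [Real.norm_eq_abs] at h1
    have := neg_abs_le (x i)
    rw [AffineMap.id_apply]
    linarith
  simpa using this

/-! ### Generic linear perturbations -/

theorem exists_mem_notMem_of_dimH_lt {n : ℕ} {B U : Set (Euc n)} (hB : dimH B < n)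
    (hU : IsOpen U) (hne : U.Nonempty) : ∃ w ∈ U, w ∉ B := by
  have h : Dense Bᶜ := dense_compl_of_dimH_lt_finrank (by simpa using hB)
  obtain ⟨w, hwU, hwB⟩ := h.inter_open_nonempty U hU hne
  exact ⟨w, hwU, hwB⟩

theorem dimH_image_le_of_contDiffAt {E F : Type*} [NormedAddCommGroup E] [NormedSpace ℝ E]
    [FiniteDimensional ℝ E] [NormedAddCommGroup F] [NormedSpace ℝ F] {f : E → F} {s : Set E}
    (hf : ∀ x ∈ s, ContDiffAt ℝ 1 f x) : dimH (f '' s) ≤ dimH s :=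
  dimH_image_le_of_locally_lipschitzOn fun x hx =>
    let ⟨C, u, hu, h⟩ := (hf x hx).exists_lipschitzOnWith
    ⟨C, u, mem_nhdsWithin_of_mem_nhds hu, h⟩

/-- A set `S` of pairs whose square has dimension less than `n` is the graph of an injective map
after a small linear perturbation. -/
theorem exists_small_injective_perturbation {N n : ℕ} {S : Set (Euc N × Euc n)}
    (hS : dimH (S ×ˢ S) < n) {ε : ℝ} (hε : 0 < ε) :
    ∃ T : Euc N →L[ℝ] Euc n, ‖T‖ < ε ∧
      ∀ a ∈ S, ∀ b ∈ S, a.2 + T a.1 = b.2 + T b.1 → a.1 = b.1 := by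
  -- Coordinates are treated one at a time: collisions are excluded among points that agree outside
  -- `J`.
  suffices H : ∀ J : Finset (Fin N), ∃ T : Euc N →L[ℝ] Euc n, ‖T‖ < ε ∧
      ∀ a ∈ S, ∀ b ∈ S, (∀ k ∉ J, a.1 k = b.1 k) → a.2 + T a.1 = b.2 + T b.1 → a.1 = b.1 by
    obtain ⟨T, hT, h⟩ := H Finset.univ
    exact ⟨T, hT, fun a ha b hb => h a ha b hb (by simp)⟩
  intro J
  induction J using Finset.induction_on with
  | empty =>
    refine ⟨0, by simpa using hε, fun a _ b _ h _ => ?_⟩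
    ext k
    exact h k (by simp)
  | insert j J hj ih =>
    obtain ⟨T, hT, h⟩ := ih
    -- `φ z` is the only `w` for which adding `x j • w` makes the pair `z` collide. Pairs with equal
    -- `j`-th coordinate are unaffected by `w`.
    let φ : (Euc N × Euc n) × (Euc N × Euc n) → Euc n := fun z =>
      (z.1.1 j - z.2.1 j)⁻¹ • ((z.2.2 + T z.2.1) - (z.1.2 + T z.1.1))
    have hφ : dimH (φ '' {z ∈ S ×ˢ S | z.1.1 j - z.2.1 j ≠ 0}) < n := by
      refine lt_of_le_of_lt (dimH_image_le_of_contDiffAt fun z hz => ?_)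
        ((dimH_mono (sep_subset _ _)).trans_lt hS)
      have hc : ContDiff ℝ 1 fun z : (Euc N × Euc n) × (Euc N × Euc n) =>
          z.1.1 j - z.2.1 j := by fun_prop
      refine (hc.contDiffAt.inv hz.2).smul ?_
      fun_prop
    let U : Set (Euc n) := {w | ‖T + (EuclideanSpace.proj j : Euc N →L[ℝ] ℝ).smulRight w‖ < ε}
    have hU : IsOpen U := by
      refine isOpen_lt (continuous_norm.comp (continuous_const.add ?_)) continuous_const
      exact (ContinuousLinearMap.smulRightL ℝ (Euc N) (Euc n) (EuclideanSpace.proj j)).continuous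
    obtain ⟨w, hwU, hw⟩ := exists_mem_notMem_of_dimH_lt hφ hU ⟨0, by simpa [U] using hT⟩
    refine ⟨_, hwU, fun a ha b hb hab heq => ?_⟩
    change a.2 + (T a.1 + a.1 j • w) = b.2 + (T b.1 + b.1 j • w) at heq
    by_cases hj : a.1 j = b.1 j
    · refine h a ha b hb (fun k hk => ?_) ?_
      · rcases eq_or_ne k j with rfl | hkj
        · exact hj
        · exact hab k (by simp [hkj, hk])
      · rw [hj, ← add_assoc, ← add_assoc] at heq
        exact add_right_cancel heq
    · refine absurd ⟨(a, b), ⟨⟨ha, hb⟩, sub_ne_zero.2 hj⟩, ?_⟩ hw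
      change (a.1 j - b.1 j)⁻¹ • ((b.2 + T b.1) - (a.2 + T a.1)) = w
      rw [inv_smul_eq_iff₀ (sub_ne_zero.2 hj), sub_smul, sub_eq_sub_iff_add_eq_add]
      rw [← add_assoc, ← add_assoc] at heq
      rw [← heq]
      abel

/-- Squares are tracked directly because the Hausdorff dimension of a product can exceed the sum of
those of its factors. -/
theorem LipschitzOnWith.dimH_prod_image_le {X Y : Type*} [EMetricSpace X] [EMetricSpace Y]
    {f : X → Y} {s : Set X} {K : ℝ≥0} (hf : LipschitzOnWith K f s) :
    dimH ((f '' s) ×ˢ (f '' s)) ≤ dimH (s ×ˢ s) := by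
  rw [← prodMap_image_prod]
  refine LipschitzOnWith.dimH_image_le (K := max (K * 1) (K * 1)) ?_
  have h1 := hf.comp (LipschitzWith.prod_fst (α := X) (β := X)).lipschitzOnWith
    (fun z (hz : z ∈ s ×ˢ s) => hz.1)
  have h2 := hf.comp (LipschitzWith.prod_snd (α := X) (β := X)).lipschitzOnWith
    (fun z (hz : z ∈ s ×ˢ s) => hz.2)
  exact h1.prodMk h2

/-- A linear map of small norm, possibly after adding a Lipschitz map, is injective on a set of
small dimension. -/
theorem exists_small_add_injOn {N n : ℕ} {M : Set (Euc N)} {g : Euc N → Euc n} {K : ℝ≥0}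
    (hg : LipschitzWith K g) (hM : dimH (M ×ˢ M) < n) {ε : ℝ} (hε : 0 < ε) :
    ∃ T : Euc N →L[ℝ] Euc n, ‖T‖ < ε ∧ InjOn (fun x => g x + T x) M := by
  have h := ((LipschitzWith.id.prodMk hg).lipschitzOnWith (s := M)).dimH_prod_image_le
  obtain ⟨T, hT, hinj⟩ := exists_small_injective_perturbation (h.trans_lt hM) hε
  exact ⟨T, hT, fun x hx y hy hxy =>
    hinj _ (mem_image_of_mem _ hx) _ (mem_image_of_mem _ hy) hxy⟩

theorem dimH_prod_le_of_lipschitz_cover {X ι : Type*} [Countable ι] [EMetricSpace X] {m : ℕ}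
    {M : Set X} (f : ι → Euc m → X) (t : ι → Set (Euc m)) (K : ι → ℝ≥0)
    (hf : ∀ i, LipschitzOnWith (K i) (f i) (t i)) (hM : M ⊆ ⋃ i, f i '' t i) :
    dimH (M ×ˢ M) ≤ (2 * m : ℕ) := by
  have h1 : M ×ˢ M ⊆ ⋃ ij : ι × ι, (Prod.map (f ij.1) (f ij.2)) '' (t ij.1 ×ˢ t ij.2) := by
    rintro ⟨x, y⟩ ⟨hx, hy⟩
    obtain ⟨i, hi⟩ := mem_iUnion.1 (hM hx)
    obtain ⟨j, hj⟩ := mem_iUnion.1 (hM hy)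
    refine mem_iUnion.2 ⟨(i, j), ?_⟩
    rw [prodMap_image_prod]
    exact ⟨hi, hj⟩
  refine (dimH_mono h1).trans ?_
  rw [dimH_iUnion]
  refine iSup_le fun ij => ?_
  have ha := (hf ij.1).comp (LipschitzWith.prod_fst (α := Euc m) (β := Euc m)).lipschitzOnWith
    (fun z (hz : z ∈ t ij.1 ×ˢ t ij.2) => hz.1)
  have hb := (hf ij.2).comp (LipschitzWith.prod_snd (α := Euc m) (β := Euc m)).lipschitzOnWith
    (fun z (hz : z ∈ t ij.1 ×ˢ t ij.2) => hz.2)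
  refine (ha.prodMk hb).dimH_image_le.trans ((dimH_mono (subset_univ _)).trans ?_)
  rw [Real.dimH_univ_eq_finrank]
  simp [two_mul]

/-! ### Injective networks with admissible activation functions -/

/-- Inverse function theorem at the point of non-zero derivative. -/
theorem IsAdmissibleActivation.exists_lipschitzOnWith_injOn {σ : ℝ → ℝ}
    (hσ : IsAdmissibleActivation σ) :
    ∃ t r : ℝ, 0 < r ∧ InjOn σ (Metric.ball t r) ∧
      ∃ K : ℝ≥0, LipschitzOnWith K σ (Metric.ball t r) := by
  obtain ⟨t, hc, hd⟩ := hσ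
  obtain ⟨K, u, hu, hK⟩ := hc.exists_lipschitzOnWith
  have hs := (hc.hasStrictDerivAt one_ne_zero).hasStrictFDerivAt_equiv hd
  have hmem : (hs.toOpenPartialHomeomorph σ).source ∈ 𝓝 t :=
    (hs.toOpenPartialHomeomorph σ).open_source.mem_nhds hs.mem_toOpenPartialHomeomorph_source
  obtain ⟨r, hr, hsub⟩ := Metric.mem_nhds_iff.1 (inter_mem hu hmem)
  refine ⟨t, r, hr, ?_, K, hK.mono (hsub.trans inter_subset_left)⟩
  have := (hs.toOpenPartialHomeomorph σ).injOn
  rw [hs.toOpenPartialHomeomorph_coe] at this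
  exact this.mono (hsub.trans inter_subset_right)

theorem lipschitzOnWith_toLp_coords {p q : ℕ} {M : Set (Euc p)} {g : Euc p → Fin q → ℝ} {K : ℝ≥0}
    (hg : ∀ i, LipschitzOnWith K (fun x => g x i) M) :
    ∃ C : ℝ≥0, LipschitzOnWith C (fun x => (WithLp.toLp 2 (g x) : Euc q)) M := by
  have h : LipschitzOnWith K g M := fun x hx y hy => by
    refine edist_pi_le_iff.2 fun i => hg i hx hy
  exact ⟨_, ((PiLp.lipschitzWith_toLp 2 fun _ : Fin q => ℝ).lipschitzOnWith (s := univ)).comp h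
    (mapsTo_univ _ _)⟩

/-- Small weights and bias `t` keep all preactivations where `σ` is injective and Lipschitz, so a
generic small linear part suffices. The Lipschitz bound lets the next layer start from the same
dimension hypothesis. -/
theorem exists_injOn_layer {p q : ℕ} {M : Set (Euc p)} (hM : IsCompact M)
    (hdim : dimH (M ×ˢ M) < q) {σ : ℝ → ℝ} (hσ : IsAdmissibleActivation σ) :
    ∃ θ : LayerParams p q, InjOn (layerMap σ θ) M ∧
      ∃ C : ℝ≥0, LipschitzOnWith C (layerMap σ θ) M := by
  obtain ⟨t, r, hr, hinj, K, hK⟩ := hσ.exists_lipschitzOnWith_injOn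
  obtain ⟨R, hR⟩ := hM.isBounded.exists_norm_le
  obtain ⟨T, hT, hTinj⟩ := exists_small_add_injOn (LipschitzWith.const (0 : Euc q)) hdim
    (ε := r / (|R| + 1)) (by positivity)
  obtain ⟨θ, hθ⟩ := exists_layerParams (T.toLinearMap.toAffineMap +
    AffineMap.const ℝ _ (WithLp.toLp 2 fun _ => t))
  have hval : layerMap σ θ = fun x => WithLp.toLp 2 fun i => σ (T x i + t) := by
    funext x
    rw [hθ]
    rfl
  have hball : ∀ x ∈ M, ∀ i, T x i + t ∈ Metric.ball t r := by
    intro x hx i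
    rw [Metric.mem_ball, Real.dist_eq, add_sub_cancel_right, ← Real.norm_eq_abs]
    refine (PiLp.norm_apply_le (T x) i).trans_lt ((T.le_opNorm x).trans_lt ?_)
    have h1 : ‖x‖ ≤ |R| := (hR x hx).trans (le_abs_self R)
    calc ‖T‖ * ‖x‖ ≤ ‖T‖ * (|R| + 1) := by gcongr; linarith
      _ < r / (|R| + 1) * (|R| + 1) := by gcongr
      _ = r := div_mul_cancel₀ _ (by positivity)
  refine ⟨θ, fun x hx y hy hxy => hTinj hx hy ?_, ?_⟩
  · rw [hval] at hxy
    simp only [zero_add]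
    ext i
    have h : σ (T x i + t) = σ (T y i + t) := congrArg (fun v : Euc q => v i) hxy
    exact add_right_cancel (hinj (hball x hx i) (hball y hy i) h)
  · rw [hval]
    refine lipschitzOnWith_toLp_coords (K := K * ‖T‖₊) fun i => ?_
    refine hK.comp (LipschitzOnWith.of_dist_le_mul fun x _ y _ => ?_) (fun x hx => hball x hx i)
    rw [dist_add_right, dist_eq_norm, dist_eq_norm]
    have h := PiLp.norm_apply_le (T x - T y) i
    rw [← map_sub] at h
    exact (by simpa using h : ‖T x i - T y i‖ ≤ ‖T (x - y)‖).trans (T.le_opNorm _)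

theorem exists_injOn_netMap {n : ℕ} (hs : List ℕ) :
    ∀ {p : ℕ} {M : Set (Euc p)}, IsCompact M → (∀ h ∈ hs, dimH (M ×ˢ M) < h) →
      dimH (M ×ˢ M) < n → ∀ σ : ℕ → ℝ → ℝ, (∀ ℓ ≤ hs.length, IsAdmissibleActivation (σ ℓ)) →
        ∃ θ : NetParams p hs n, InjOn (netMap σ hs θ) M ∧ ContinuousOn (netMap σ hs θ) M := by
  induction hs with
  | nil =>
    intro p M hM _ hn σ hσ
    obtain ⟨θ, hθ, C, hC⟩ := exists_injOn_layer hM hn (hσ 0 le_rfl)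
    exact ⟨θ, hθ, hC.continuousOn⟩
  | cons h hs ih =>
    intro p M hM hh hn σ hσ
    obtain ⟨θ₁, hθ₁, C, hC⟩ := exists_injOn_layer hM (hh h (by simp)) (hσ 0 (by simp))
    have hd := hC.dimH_prod_image_le
    obtain ⟨θ, hθ, hcont⟩ := ih (hM.image_of_continuousOn hC.continuousOn)
      (fun h' hh' => hd.trans_lt (hh h' (by simp [hh']))) (hd.trans_lt hn)
      (fun ℓ => σ (ℓ + 1)) (fun ℓ hℓ => hσ (ℓ + 1) (by simpa using hℓ))
    exact ⟨(θ₁, θ), hθ.comp hθ₁ (mapsTo_image _ _),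
      hcont.comp hC.continuousOn (mapsTo_image _ _)⟩

/-! ### Injective continuous maps of compact manifolds into `ℝⁿ` -/

theorem exists_continuous_extend {X Y : Type*} [TopologicalSpace X] [CompactSpace X]
    [TopologicalSpace Y] [T2Space Y] [NormalSpace Y] {k : ℕ} {e : X → Y} (he : Continuous e)
    (hinj : Function.Injective e) {f : X → Euc k} (hf : Continuous f) :
    ∃ g : Y → Euc k, Continuous g ∧ ∀ x, g (e x) = f x := by
  obtain ⟨g, hg⟩ := ContinuousMap.exists_extension' (he.isClosedEmbedding hinj)
    (⟨fun x => (f x).ofLp, by fun_prop⟩ : C(X, Fin k → ℝ))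
  refine ⟨fun y => WithLp.toLp 2 (g y), by fun_prop, fun x => ?_⟩
  have := congrFun hg x
  simp only [Function.comp_apply, ContinuousMap.coe_mk] at this
  simp only [this]

theorem exists_continuous_extendOn {X Y : Type*} [TopologicalSpace X] [TopologicalSpace Y]
    [T2Space Y] [NormalSpace Y] {k : ℕ} {A : Set X} (hA : IsCompact A) {e : X → Y}
    (he : ContinuousOn e A) (hinj : InjOn e A) {f : X → Euc k} (hf : ContinuousOn f A) :
    ∃ g : Y → Euc k, Continuous g ∧ ∀ x ∈ A, g (e x) = f x := by
  have := isCompact_iff_compactSpace.1 hA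
  obtain ⟨g, hg, h⟩ := exists_continuous_extend (continuousOn_iff_continuous_domRestrict.1 he)
    (injOn_iff_injective.1 hinj) (continuousOn_iff_continuous_domRestrict.1 hf)
  exact ⟨g, hg, fun x hx => h ⟨x, hx⟩⟩

theorem hasZeroRepresentationError_of_injOn {N n : ℕ} {M : Set (Euc N)} (hM : IsCompact M)
    {E : Euc N → Euc n} (hE : ContinuousOn E M) (hinj : InjOn E M) :
    HasZeroRepresentationError M E :=
  ⟨hinj, exists_continuous_extendOn hM hE hinj continuousOn_id⟩

theorem exists_continuous_clip {n : ℕ} {ε : ℝ} (hε : 0 < ε) :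
    ∃ ρ : Euc n → Euc n, Continuous ρ ∧ (∀ v, ‖ρ v‖ ≤ ε) ∧ ∀ v, ‖v‖ ≤ ε → ρ v = v := by
  refine ⟨fun v => (ε / max ε ‖v‖) • v, ?_, fun v => ?_, fun v hv => ?_⟩
  · have h : ∀ v : Euc n, max ε ‖v‖ ≠ 0 := fun v => (lt_max_of_lt_left hε).ne'
    exact (continuous_const.div (continuous_const.max continuous_norm) h).smul continuous_id
  · have h : 0 < max ε ‖v‖ := lt_max_of_lt_left hε
    rw [norm_smul, Real.norm_of_nonneg (by positivity), div_mul_eq_mul_div, div_le_iff₀ h]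
    exact mul_le_mul_of_nonneg_left (le_max_right _ _) hε.le
  · simp only
    rw [max_eq_left hv, div_self hε.ne', one_smul]

/-- On `A`, `f` factors through `φ`; the factor has Lipschitz clamp-chain approximations. -/
theorem exists_lipschitz_approx_of_injOn {X : Type*} [TopologicalSpace X] [CompactSpace X]
    {m n : ℕ} {A : Set X} (hA : IsClosed A)
    {φ : X → Euc m} (hφ : Continuous φ) (hinj : InjOn φ A) (f : C(X, Euc n)) {ε : ℝ}
    (hε : 0 < ε) :
    ∃ g : Euc m → Euc n, (∃ K : ℝ≥0, LipschitzWith K g) ∧ ∀ x ∈ A, ‖g (φ x) - f x‖ ≤ ε := by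
  obtain ⟨F, hF, hFf⟩ := exists_continuous_extendOn hA.isCompact hφ.continuousOn hinj
    f.continuous.continuousOn
  obtain ⟨d, hd⟩ := exists_clampChain_approx hF (hA.isCompact.image hφ) hε
  obtain ⟨l, -, hl⟩ := hd d le_rfl
  refine ⟨fun v => clampChain l v 0,
    exists_lipschitzWith_clampChain l _ ⟨0, LipschitzWith.const 0⟩, fun x hx => ?_⟩
  rw [← hFf x hx]
  exact hl _ (mem_image_of_mem _ hx)

/-- Change `f` to `g ∘ φ + w` on `A` and to `h ∘ ψ` on `B`, with `g`, `h` Lipschitz. A collision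
puts `w` in a Lipschitz image of ℝ²ᵐ, which some small `w` avoids. -/
theorem dense_setOf_disjoint_image {X : Type*} [TopologicalSpace X] [CompactSpace X] [NormalSpace X]
    {m n : ℕ} (hmn : 2 * m < n) {A B : Set X} (hA : IsClosed A)
    (hB : IsClosed B) (hAB : Disjoint A B) {φ ψ : X → Euc m} (hφ : Continuous φ)
    (hψ : Continuous ψ) (hφA : InjOn φ A) (hψB : InjOn ψ B) :
    Dense {f : C(X, Euc n) | ∀ x ∈ A, ∀ y ∈ B, f x ≠ f y} := by
  rw [Metric.dense_iff]
  intro f ε hε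
  obtain ⟨g, ⟨K, hK⟩, hg⟩ := exists_lipschitz_approx_of_injOn hA hφ hφA f (ε := ε / 4)
    (by positivity)
  obtain ⟨h, ⟨C, hC⟩, hh⟩ := exists_lipschitz_approx_of_injOn hB hψ hψB f (ε := ε / 4)
    (by positivity)
  have hbad : dimH (range fun z : Euc m × Euc m => h z.2 - g z.1) < n := by
    refine lt_of_le_of_lt ((hC.comp LipschitzWith.prod_snd).sub
      (hK.comp LipschitzWith.prod_fst)).dimH_range_le ?_
    rw [Real.dimH_univ_eq_finrank]
    have : ((m + m : ℕ) : ENNReal) < n := by exact_mod_cast two_mul m ▸ hmn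
    simpa using this
  obtain ⟨w, hw, hwbad⟩ := exists_mem_notMem_of_dimH_lt hbad
    (Metric.isOpen_ball (x := (0 : Euc n)) (ε := ε / 4)) ⟨0, by simpa using hε⟩
  -- Clipping keeps the correction small away from `A` and `B`, where nothing controls it, and
  -- changes nothing where it is used on them.
  obtain ⟨ρ, hρ, hρle, hρid⟩ := exists_continuous_clip (n := n) (half_pos hε)
  obtain ⟨u, hu0, hu1, hu⟩ := exists_continuous_zero_one_of_isClosed hA hB hAB
  let δ : X → Euc n := fun x =>
    (1 - u x) • ρ (g (φ x) + w - f x) + u x • ρ (h (ψ x) - f x)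
  have hδ : Continuous δ := by
    have := hK.continuous
    have := hC.continuous
    fun_prop
  have hδle : ∀ x, ‖δ x‖ ≤ ε / 2 := by
    intro x
    have h1 := (hu x).1
    have h2 := (hu x).2
    refine (norm_add_le _ _).trans ?_
    rw [norm_smul, norm_smul, Real.norm_of_nonneg h1, Real.norm_of_nonneg (by linarith)]
    have h3 := mul_le_mul_of_nonneg_left (hρle (g (φ x) + w - f x)) (sub_nonneg.2 h2)
    have h4 := mul_le_mul_of_nonneg_left (hρle (h (ψ x) - f x)) h1
    linarith
  refine ⟨f + ⟨δ, hδ⟩, ?_, fun x hx y hy hxy => hwbad ⟨(φ x, ψ y), ?_⟩⟩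
  · rw [Metric.mem_ball, dist_eq_norm, add_sub_cancel_left]
    exact ((ContinuousMap.norm_le _ (by positivity)).2 hδle).trans_lt (by linarith)
  · have hx' : f x + δ x = g (φ x) + w := by
      have h1 : ‖g (φ x) + w - f x‖ ≤ ε / 2 := by
        rw [add_sub_right_comm]
        refine (norm_add_le _ _).trans ?_
        have := hg x hx
        rw [mem_ball_zero_iff] at hw
        linarith
      simp only [δ, hu0 hx, hρid _ h1, Pi.zero_apply]
      simp
    have hy' : f y + δ y = h (ψ y) := by
      have h1 : ‖h (ψ y) - f y‖ ≤ ε / 2 := (hh y hy).trans (by linarith)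
      simp only [δ, hu1 hy, hρid _ h1, Pi.one_apply]
      simp
    have hxy' : f x + δ x = f y + δ y := hxy
    rw [hx', hy'] at hxy'
    change h (ψ y) - g (φ x) = w
    rw [← hxy']
    abel

theorem isOpen_setOf_disjoint_image {X : Type*} [TopologicalSpace X] [CompactSpace X]
    {n : ℕ} {A B : Set X} (hA : IsClosed A) (hB : IsClosed B) :
    IsOpen {f : C(X, Euc n) | ∀ x ∈ A, ∀ y ∈ B, f x ≠ f y} := by
  let Φ : C(X, Euc n) → C(X × X, Euc n) := fun f =>
    f.comp ContinuousMap.fst - f.comp ContinuousMap.snd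
  have hΦ : Continuous Φ :=
    (ContinuousMap.continuous_precomp _).sub (ContinuousMap.continuous_precomp _)
  have h := (ContinuousMap.isOpen_setOfPred_mapsTo (hA.isCompact.prod hB.isCompact)
    (isOpen_compl_singleton (x := (0 : Euc n)))).preimage hΦ
  convert h using 1
  ext f
  simp only [mem_ofPred_eq, mem_preimage, MapsTo, mem_prod, mem_compl_iff, mem_singleton_iff,
    Prod.forall, Φ]
  exact ⟨fun H x y hxy => sub_ne_zero.2 (H x hxy.1 y hxy.2),
    fun H x hx y hy => sub_ne_zero.1 (H x y ⟨hx, hy⟩)⟩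

/-- A compact metrizable space which locally embeds into `ℝᵐ` embeds into `ℝⁿ` for every
`n > 2 m`. -/
theorem exists_injective_continuousMap {X : Type*} [TopologicalSpace X] [CompactSpace X]
    [T2Space X] [SecondCountableTopology X] {m n : ℕ} (hmn : 2 * m < n)
    (hX : ∀ x : X, ∃ U ∈ 𝓝 x, ∃ φ : X → Euc m, ContinuousOn φ U ∧ InjOn φ U) :
    ∃ f : C(X, Euc n), Function.Injective f := by
  let b := TopologicalSpace.countableBasis X
  have hb := TopologicalSpace.isBasis_countableBasis X
  let good : Set X → Prop := fun u => ∃ φ : X → Euc m, Continuous φ ∧ InjOn φ (closure u)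
  -- Countably many such pairs separate all pairs of distinct points, as Baire's theorem requires.
  let I := {uv : b × b // Disjoint (closure uv.1.1) (closure uv.2.1) ∧ good uv.1.1 ∧ good uv.2.1}
  let G : I → Set C(X, Euc n) := fun i =>
    {f | ∀ x ∈ closure i.1.1.1, ∀ y ∈ closure i.1.2.1, f x ≠ f y}
  have hcount : Countable I := by
    have : Countable b := TopologicalSpace.countable_countableBasis X
    exact Subtype.countable
  have hG : Dense (⋂ i, G i) := by
    refine dense_iInter_of_isOpen
      (fun i => isOpen_setOf_disjoint_image isClosed_closure isClosed_closure) fun i => ?_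
    obtain ⟨hd, ⟨φ, hφ, hφi⟩, ψ, hψ, hψi⟩ := i.2
    exact dense_setOf_disjoint_image hmn isClosed_closure isClosed_closure hd hφ hψ hφi hψi
  obtain ⟨f, hf⟩ := hG.nonempty
  have hgood : ∀ x : X, ∀ V ∈ 𝓝 x, ∃ u ∈ b, x ∈ u ∧ closure u ⊆ V ∧ good u := by
    intro x V hV
    obtain ⟨U, hU, φ, hφ, hφi⟩ := hX x
    obtain ⟨u, hub, hxu, hu⟩ := hb.exists_closure_subset (inter_mem hV hU)
    refine ⟨u, hub, hxu, hu.trans inter_subset_left, ?_⟩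
    have huU := hu.trans inter_subset_right
    -- `φ` is continuous only on `U`; its restriction to `closure u` is extended to all of `X`.
    obtain ⟨g, hg, hgφ⟩ := exists_continuous_extendOn (isClosed_closure (s := u)).isCompact
      continuousOn_id (injOn_id _) (hφ.mono huU)
    exact ⟨g, hg, (hφi.mono huU).congr fun x hx => (hgφ x hx).symm⟩
  refine ⟨f, fun x y hxy => ?_⟩
  by_contra hne
  obtain ⟨V, W, hV, hW, hxV, hyW, hVW⟩ := t2_separation hne
  obtain ⟨u, hub, hxu, huV, hug⟩ := hgood x V (hV.mem_nhds hxV)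
  obtain ⟨v, hvb, hyv, hvW, hvg⟩ := hgood y W (hW.mem_nhds hyW)
  exact mem_iInter.1 hf ⟨(⟨u, hub⟩, ⟨v, hvb⟩), hVW.mono huV hvW, hug, hvg⟩ x (subset_closure hxu)
    y (subset_closure hyv) hxy

/-! ### Manifolds in `ℝᴺ` -/

theorem exists_isExactAutoencoder {m n N : ℕ} (hmn : 2 * m < n) {H : Type*} [TopologicalSpace H]
    (I : ModelWithCorners ℝ (Euc m) H) (M : Set (Euc N)) (hM : IsCompact M) [ChartedSpace H M] :
    ∃ (E : Euc N → Euc n) (D : Euc n → Euc N), IsExactAutoencoder M E D := by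
  have := isCompact_iff_compactSpace.1 hM
  obtain ⟨f, hf⟩ := exists_injective_continuousMap (X := M) hmn fun x =>
    ⟨_, extChartAt_source_mem_nhds (I := I) x, extChartAt I x, continuousOn_extChartAt x,
      (extChartAt I x).injOn⟩
  obtain ⟨E, hE, hEf⟩ := exists_continuous_extend continuous_subtype_val
    (Subtype.val_injective (p := (· ∈ M))) f.continuous
  obtain ⟨D, hD, hDf⟩ := exists_continuous_extend f.continuous hf
    (continuous_subtype_val (p := (· ∈ M)))
  exact ⟨E, D, hE, hD, fun x hx => by rw [hEf ⟨x, hx⟩, hDf]⟩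

theorem IsLipschitzParametrized.dimH_prod_le {m N : ℕ} {H : Type*} [TopologicalSpace H]
    {I : ModelWithCorners ℝ (Euc m) H} {M : Set (Euc N)} [ChartedSpace H M]
    (h : IsLipschitzParametrized I M) : dimH (M ×ˢ M) ≤ (2 * m : ℕ) := by
  choose K t ht hK using h
  have hV : ∀ p : M, (extChartAt I p).source ∩ extChartAt I p ⁻¹' t p ∈ 𝓝 p := fun p => by
    refine inter_mem (extChartAt_source_mem_nhds p) ?_
    have := ht p
    rwa [← map_extChartAt_nhds] at this
  obtain ⟨s, hs, hcov⟩ := TopologicalSpace.countable_cover_nhds hV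
  have := hs.to_subtype
  refine dimH_prod_le_of_lipschitz_cover (ι := s) _ (fun p => t p) (fun p => K p)
    (fun p => hK p) fun x hx => ?_
  have hx' : (⟨x, hx⟩ : M) ∈ ⋃ p ∈ s, (extChartAt I p).source ∩ extChartAt I p ⁻¹' t p :=
    hcov ▸ mem_univ _
  obtain ⟨p, hps, hp, hpt⟩ := mem_iUnion₂.1 hx'
  exact mem_iUnion.2 ⟨⟨p, hps⟩, _, hpt, congrArg Subtype.val ((extChartAt I p).left_inv hp)⟩

/-! ### Approximation by ReLU networks -/

/-- Half of `ε` pays for the chain, half for the linear map that makes it injective. -/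
theorem exists_reluNet_approx {N n : ℕ} {f : Euc N → Euc n} (hf : Continuous f)
    {K : Set (Euc N)} (hK : IsCompact K) {ε : ℝ} (hε : 0 < ε) :
    ∃ d₀ : ℕ, ∀ d, d₀ ≤ d → ∃ θ : NetParams N (List.replicate d (N + n)) n,
      (∀ x ∈ K, ‖reluNet d (N + n) θ x - f x‖ ≤ ε) ∧
      ContinuousOn (reluNet d (N + n) θ) K ∧
      (dimH (K ×ˢ K) < n → InjOn (reluNet d (N + n) θ) K) := by
  obtain ⟨R, hR⟩ := hK.isBounded.exists_norm_le
  obtain ⟨d₀, h⟩ := exists_clampChain_approx hf hK (half_pos hε)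
  refine ⟨d₀, fun d hd => ?_⟩
  obtain ⟨l, rfl, hl⟩ := h d hd
  obtain ⟨C, hC⟩ := exists_lipschitzWith_clampChain l _ ⟨0, LipschitzWith.const 0⟩
  obtain ⟨T, hT, hinj⟩ : ∃ T : Euc N →L[ℝ] Euc n, ‖T‖ < ε / 2 / (|R| + 1) ∧
      (dimH (K ×ˢ K) < n → InjOn (fun x => clampChain l x 0 + T x) K) := by
    by_cases hdim : dimH (K ×ˢ K) < n
    · obtain ⟨T, hT, hinj⟩ := exists_small_add_injOn hC hdim
        (ε := ε / 2 / (|R| + 1)) (by positivity)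
      exact ⟨T, hT, fun _ => hinj⟩
    · exact ⟨0, by rw [norm_zero]; positivity, fun h => absurd h hdim⟩
  obtain ⟨θ, hθ⟩ := exists_reluNet_eq_on hK T l
  have heq : EqOn (fun x => clampChain l x 0 + T x) (reluNet l.length (N + n) θ) K :=
    fun x hx => (hθ x hx).symm
  refine ⟨θ, fun x hx => ?_, ?_, fun hdim => (hinj hdim).congr heq⟩
  · have h1 : ‖x‖ ≤ |R| := (hR x hx).trans (le_abs_self R)
    have h2 : ‖T x‖ ≤ ε / 2 := calc
      ‖T x‖ ≤ ‖T‖ * ‖x‖ := T.le_opNorm x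
      _ ≤ ε / 2 / (|R| + 1) * (|R| + 1) := by gcongr; linarith
      _ = ε / 2 := div_mul_cancel₀ _ (by positivity)
    rw [hθ x hx, add_sub_right_comm]
    exact (norm_add_le _ _).trans (by linarith [hl x hx])
  · exact (hC.continuous.add T.continuous).continuousOn.congr heq.symm

/-- Only finitely many depths lie below `d₀`, so a weight count above all of theirs forces
sufficient depth. -/
theorem exists_forall_le_of_forall_le (u : ℕ → ℕ) (d₀ : ℕ) :
    ∃ P : ℕ, ∀ d, P ≤ u d → d₀ ≤ d := by
  refine ⟨1 + ∑ d ∈ Finset.range d₀, u d, fun d hd => ?_⟩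
  by_contra! h
  have := Finset.single_le_sum (f := u) (fun _ _ => Nat.zero_le _) (Finset.mem_range.2 h)
  omega

theorem mainTheorem5 {m n N : ℕ} (hmn : m ≤ n) (hnN : n < N)
    {H : Type*} [TopologicalSpace H] (I : ModelWithCorners ℝ (Euc m) H)
    (M : Set (Euc N)) (hM : IsCompact M) [ChartedSpace H M] :
    -- a latent size of at least `2 m + 1` is large enough for an exact continuous autoencoder
    (2 * m + 1 ≤ n →
      ∃ (E : Euc N → Euc n) (D : Euc n → Euc N), IsExactAutoencoder M E D) ∧
    -- hidden widths at least `n_in = N` suffice for an injective encoder network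
    (2 * m + 1 ≤ n → IsLipschitzParametrized I M →
      ∀ hs : List ℕ, (∀ h ∈ hs, N ≤ h) →
      ∀ σ : ℕ → ℝ → ℝ, (∀ ℓ ≤ hs.length, IsAdmissibleActivation (σ ℓ)) →
        ∃ θ : NetParams N hs n, HasZeroRepresentationError M (netMap σ hs θ)) ∧
    -- hidden widths `n_in + n_out` suffice for zero representation error together with
    -- an approximation error that vanishes as the number of weights tends to infinity
    (∀ (E : Euc N → Euc n) (D : Euc n → Euc N), IsExactAutoencoder M E D →
      ∀ ε : ℝ, 0 < ε → ∃ P : ℕ,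
        ∀ d : ℕ, P ≤ numParams N (List.replicate d (N + n)) n →
          ∃ θ : NetParams N (List.replicate d (N + n)) n,
            (∀ x ∈ M, ‖reluNet d (N + n) θ x - E x‖ ≤ ε) ∧
            (2 * m + 1 ≤ n → IsLipschitzParametrized I M →
              HasZeroRepresentationError M (reluNet d (N + n) θ)) ∧
            ∀ d' : ℕ, P ≤ numParams n (List.replicate d' (n + N)) N →
              ∃ θ' : NetParams n (List.replicate d' (n + N)) N,
                (∀ x ∈ M, ‖reluNet d' (n + N) θ' (E x) - x‖ ≤ ε) ∧
                ∀ x ∈ M, ‖reluNet d' (n + N) θ' (reluNet d (N + n) θ x) - x‖ ≤ ε) := by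
  refine ⟨fun h => exists_isExactAutoencoder h I M hM, fun h hLip hs hhs σ hσ => ?_,
    fun E D hED ε hε => ?_⟩
  · have hdim := hLip.dimH_prod_le
    have hlt : ∀ k : ℕ, 2 * m + 1 ≤ k → dimH (M ×ˢ M) < k := fun k hk =>
      hdim.trans_lt (Nat.cast_lt.2 hk)
    obtain ⟨θ, hinj, hcont⟩ := exists_injOn_netMap hs hM
      -- Hidden widths satisfy `2 * m + 1 ≤ n < N ≤ k`.
      (fun k hk => hlt k (by have := hhs k hk; omega)) (hlt n h) σ hσ
    exact ⟨θ, hasZeroRepresentationError_of_injOn hM hcont hinj⟩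
  -- The decoder is approximated on a neighbourhood of the exact codes, to accept inexact ones.
  · let K := Metric.cthickening 1 (E '' M)
    have hEM := hM.image hED.continuous_encoder
    have hK : IsCompact K := hEM.cthickening
    obtain ⟨δ, hδ, hDδ⟩ := Metric.uniformContinuousOn_iff.1
      (hK.uniformContinuousOn_of_continuous hED.continuous_decoder.continuousOn) (ε / 2)
      (half_pos hε)
    -- The bound `1` keeps the network's codes in `K`; `δ / 2` makes `D` move by less than `ε / 2`.
    obtain ⟨d₀, hd₀⟩ := exists_reluNet_approx hED.continuous_encoder hM
      (ε := min ε (min 1 (δ / 2))) (by positivity)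
    obtain ⟨d₁, hd₁⟩ := exists_reluNet_approx hED.continuous_decoder hK (half_pos hε)
    obtain ⟨P, hP⟩ := exists_forall_le_of_forall_le
      (fun d => numParams N (List.replicate d (N + n)) n) d₀
    obtain ⟨Q, hQ⟩ := exists_forall_le_of_forall_le
      (fun d => numParams n (List.replicate d (n + N)) N) d₁
    refine ⟨max P Q, fun d hd => ?_⟩
    obtain ⟨θ, hθ, hcont, hinj⟩ := hd₀ d (hP d ((le_max_left _ _).trans hd))
    refine ⟨θ, fun x hx => (hθ x hx).trans (min_le_left _ _), fun h hLip =>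
      hasZeroRepresentationError_of_injOn hM hcont
        (hinj (hLip.dimH_prod_le.trans_lt (Nat.cast_lt.2 h))), fun d' hd' => ?_⟩
    obtain ⟨θ', hθ', -, -⟩ := hd₁ d' (hQ d' ((le_max_right _ _).trans hd'))
    have hEK : ∀ x ∈ M, E x ∈ K := fun x hx =>
      Metric.self_subset_cthickening _ (mem_image_of_mem E hx)
    refine ⟨θ', fun x hx => ?_, fun x hx => ?_⟩
    · have := hθ' (E x) (hEK x hx)
      rw [hED.decode_encode x hx] at this
      linarith
    · have h1 := hθ x hx
      rw [← dist_eq_norm] at h1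
      have hNK : reluNet d (N + n) θ x ∈ K :=
        Metric.mem_cthickening_of_dist_le _ _ _ _ (mem_image_of_mem E hx)
          (h1.trans ((min_le_right _ _).trans (min_le_left _ _)))
      have h2 := hDδ _ hNK _ (hEK x hx)
        (h1.trans_lt (((min_le_right _ _).trans (min_le_right _ _)).trans_lt (half_lt_self hδ)))
      have h3 := hθ' _ hNK
      rw [hED.decode_encode x hx] at h2
      rw [← dist_eq_norm] at h3 ⊢
      linarith [dist_triangle (reluNet d' (n + N) θ' (reluNet d (N + n) θ x))
        (D (reluNet d (N + n) θ x)) x]
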